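/- Let $S$ be a Noetherian scheme, let $X$ and $R$ be reduced $S$-schemes with $X\to S$ finite, and let $p_1,p_2\colon R\rightrightarrows X$ be a finite set-theoretic equivalence relation over $S$; that is, $p_1,p_2$ are finite $S$-morphisms and, for every geometric point $\operatorname{Spec}K\to S$ ($K$ algebraically closed), the map $(p_1,p_2)\colon \operatorname{Mor}_S(\operatorname{Spec}K,R)\to \operatorname{Mor}_S(\operatorname{Spec}K,X)\times \operatorname{Mor}_S(\operatorname{Spec}K,X)$ is injective and its image is an equivalence relation on $\operatorname{Mor}_S(\operatorname{Spec}K,X)$. Then the geometric quotient $q\colon X\to Y=X/R$ exists, and $Y$ is the relative spectrum over $S$ of the $\mathcal O_S$-algebra $\ker\bigl[\mathcal O_X\xrightarrow{\,p_1^*-p_2^*\,}\mathcal O_R\bigr]$ (where $\mathcal O_X$ and $\mathcal O_R$ are identified with their direct images on $S$). Explicitly, there are an $S$-scheme $Y$, affine over $S$, and an $S$-morphism $q\colon X\to Y$ such that $q^*$ identifies the direct image of $\mathcal O_Y$ on $S$ with this kernel, and 1. $q$ is the coequalizer of $p_1,p_2\colon R\rightrightarrows X$ in the category of schemes; 2.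 $q$ is finite; 3. for every geometric point $\operatorname{Spec}K\to S$, the fibers of $\operatorname{Mor}_S(\operatorname{Spec}K,X)\to \operatorname{Mor}_S(\operatorname{Spec}K,Y)$ are exactly the equivalence classes of the relation on $\operatorname{Mor}_S(\operatorname{Spec}K,X)$ defined by $R$. -/

import Mathlib

open CategoryTheory Limits AlgebraicGeometry

universe u

noncomputable section

namespace SchemeQuotient

variable {S : Scheme.{u}}

/-- The relation on `T`-points of the `S`-scheme `X` given by a pair of `S`-morphisms
`p₁, p₂ : R ⇉ X`: the image of `Mor_S(T, R)` in `Mor_S(T, X) × Mor_S(T, X)`. -/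
def PointRel {R X : Over S} (p₁ p₂ : R ⟶ X) (T : Over S) (x x' : T ⟶ X) : Prop :=
  ∃ r : T ⟶ R, r ≫ p₁ = x ∧ r ≫ p₂ = x'

/-- A set theoretic equivalence relation `p₁, p₂ : R ⇉ X` over `S`: the `S`-schemes `X` and `R`
are reduced and, for every geometric point `s : Spec K ⟶ S`, the map
`Mor_S(Spec K, R) → Mor_S(Spec K, X) × Mor_S(Spec K, X)` is injective and its image is an
equivalence relation. -/
structure IsSetTheoreticEquivRel {R X : Over S} (p₁ p₂ : R ⟶ X) : Prop where
  isReduced_source : IsReduced R.left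
  isReduced_target : IsReduced X.left
  injective (K : Type u) [Field K] [IsAlgClosed K] (s : Spec (CommRingCat.of K) ⟶ S) :
    Function.Injective fun r : Over.mk s ⟶ R ↦ (r ≫ p₁, r ≫ p₂)
  equivalence (K : Type u) [Field K] [IsAlgClosed K] (s : Spec (CommRingCat.of K) ⟶ S) :
    Equivalence (PointRel p₁ p₂ (Over.mk s))

/-- A finite set theoretic equivalence relation: both `p₁` and `p₂` are finite morphisms. -/
structure IsFiniteSetTheoreticEquivRel {R X : Over S} (p₁ p₂ : R ⟶ X) : Prop extends
    IsSetTheoreticEquivRel p₁ p₂ where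
  isFinite_fst : IsFinite p₁.left
  isFinite_snd : IsFinite p₂.left

/-- `q : X ⟶ Y` is a categorical quotient of `p₁, p₂ : R ⇉ X`: it is a coequalizer in the category
of all schemes. -/
def IsCategoricalQuotient {R X Y : Over S} (p₁ p₂ : R ⟶ X) (q : X ⟶ Y) : Prop :=
  ∃ w : p₁.left ≫ q.left = p₂.left ≫ q.left, Nonempty (IsColimit (Cofork.ofπ q.left w))

/-- `q : X ⟶ Y` is a geometric quotient of `X` by `p₁, p₂ : R ⇉ X`: it is the categorical quotient,
it is finite and, for every geometric point `s : Spec K ⟶ S`, the fibres of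
`Mor_S(Spec K, X) → Mor_S(Spec K, Y)` over the points of its target are exactly the equivalence
classes of the relation defined by `R`. (`Mor_S(Spec K, X)` is the set of `K`-points of the
base change `X_K`.) -/
structure IsGeometricQuotient {R X Y : Over S} (p₁ p₂ : R ⟶ X) (q : X ⟶ Y) : Prop where
  isCategoricalQuotient : IsCategoricalQuotient p₁ p₂ q
  isFinite : IsFinite q.left
  range_fiber_eq (K : Type u) [Field K] [IsAlgClosed K] (s : Spec (CommRingCat.of K) ⟶ S) :
    (Set.range fun y : Over.mk s ⟶ Y ↦ {x : Over.mk s ⟶ X | x ≫ q = y}) =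
      Set.range fun x : Over.mk s ⟶ X ↦ {x' : Over.mk s ⟶ X | PointRel p₁ p₂ (Over.mk s) x x'}

/-- Sections over the open `U ⊆ S` of the direct image on `S` of the structure sheaf of the
`S`-scheme `X`. -/
abbrev sectionsOver (X : Over S) (U : S.Opens) : CommRingCat.{u} :=
  Γ(X.left, X.hom ⁻¹ᵁ U)

lemma preimage_le {X Y : Over S} (f : X ⟶ Y) (U : S.Opens) :
    X.hom ⁻¹ᵁ U ≤ f.left ⁻¹ᵁ (Y.hom ⁻¹ᵁ U) := by
  rw [← Scheme.Hom.comp_preimage, Over.w]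

/-- The pullback of functions `f^*` along a morphism `f : X ⟶ Y` of `S`-schemes, on sections over
`U ⊆ S` of the direct images of the structure sheaves on `S`. -/
def pullbackSections {X Y : Over S} (f : X ⟶ Y) (U : S.Opens) :
    sectionsOver Y U →+* sectionsOver X U :=
  (f.left.appLE (Y.hom ⁻¹ᵁ U) (X.hom ⁻¹ᵁ U) (preimage_le f U)).hom

/-- `q : X ⟶ Y` exhibits `Y` as the relative spectrum over `S` of the `𝒪_S`-algebra
`ker [p₁^* - p₂^* : 𝒪_X ⟶ 𝒪_R]`: the scheme `Y` is affine over `S`, and `q^*` maps the direct image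
of `𝒪_Y` on `S` isomorphically onto that kernel, as a subalgebra of the direct image of `𝒪_X`. -/
structure IsSpecKernel {R X Y : Over S} (p₁ p₂ : R ⟶ X) (q : X ⟶ Y) : Prop where
  isAffineHom : IsAffineHom Y.hom
  injective (U : S.Opens) : Function.Injective (pullbackSections q U)
  mem_range_iff (U : S.Opens) (a : sectionsOver X U) :
    a ∈ (pullbackSections q U).range ↔ pullbackSections p₁ U a - pullbackSections p₂ U a = 0

end SchemeQuotient

end

/-!
The quotient `Y` is the relative spectrum of the kernel of `p₁^* - p₂^*`, and the point of the proof
is that its geometric fibres are not too large: two geometric points of `X` with the same image in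
`Y` are related by `R`.

This is affine-local on `Y`. Let `X = Spec B` and `R = Spec C` over `Y = Spec A`, with `A` the
equalizer of `B ⇉ C`, and fix a geometric point `A → K`. There is a flat `A`-algebra `T`, local,
with `A → K` factoring through its residue field, over which the minimal equations of generators of
`B` split (`exists_flat_splits`). Over `T` any set of `K`-points of the fibre of `B` is cut out by
an idempotent of `T ⊗[A] B` (`exists_flat_isIdempotentElem`). Take for the set an equivalence class
of `R`. The two pullbacks of its idempotent to `T ⊗[A] C` agree at all `K`-points, as the class is
stable under the relation, so they are equal (`IsIdempotentElem.eq_of_forall_algHom`). By flatness,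
the equalizer of `T ⊗[A] B ⇉ T ⊗[A] C` is the image of `T`. Hence the idempotent comes from `T` and
is constant on the fibre, which therefore is a single class
(`exists_algHom_comp_eq_of_equivalence`).

Globally, equalizers commute with localization (`isLocalizationAway_eqLocus`), so the spectra of the
kernels over the affine opens of `S` glue to `specKernel`, and `𝒪_Y` is the kernel of `p₁^* - p₂^*`
over every open of `Y` (`isKernelOn_overToSpecKernel`). The morphism `q : X ⟶ Y` is finite because
`X ⟶ S` is finite and `Y ⟶ S` is affine; it is closed, and surjective because `𝒪_Y` embeds into
`q_* 𝒪_X`. So `Y` carries the quotient topology, its points are the classes of points of `X`, and its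
functions are the invariant functions; a morphism from `X` that coequalizes `p₁` and `p₂` thus
descends, first as a continuous map and then on sheaves (`exists_hom_comp_eq_of_isQuotientMap`).
-/

noncomputable section

namespace SchemeQuotient

/-! ### Idempotents that separate geometric points -/

section Algebra

open Polynomial TensorProduct

/-- A prime of an integral `A`-algebra that lies over the kernel of a geometric point `A → K` is the
kernel of a geometric point extending it. -/
theorem exists_algHom_ker_eq {A B K : Type*} [CommRing A] [CommRing B] [Algebra A B]
    [Algebra.IsIntegral A B] [Field K] [IsAlgClosed K] [Algebra A K] (Q : Ideal B) [Q.IsPrime]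
    (hQ : Q.comap (algebraMap A B) = RingHom.ker (algebraMap A K)) :
    ∃ ψ : B →ₐ[A] K, RingHom.ker ψ = Q := by
  set P : Ideal A := Q.comap (algebraMap A B) with hP
  have : Q.LiesOver P := ⟨rfl⟩
  let φ : A ⧸ P →+* K := Ideal.Quotient.lift P (algebraMap A K) fun a ha ↦ by
    rwa [hQ, RingHom.mem_ker] at ha
  let : Algebra (A ⧸ P) K := φ.toAlgebra
  have hinj : Function.Injective (algebraMap (A ⧸ P) K) :=
    RingHom.lift_injective_of_ker_le_ideal _ _ hQ.ge
  have : FaithfulSMul (A ⧸ P) K := (faithfulSMul_iff_algebraMap_injective _ _).mpr hinj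
  have : IsScalarTower A (A ⧸ P) K := .of_algebraMap_eq' rfl
  have : Algebra.IsIntegral (A ⧸ P) (B ⧸ Q) := inferInstance
  have : FaithfulSMul (A ⧸ P) (B ⧸ Q) :=
    (faithfulSMul_iff_algebraMap_injective _ _).mpr (Ideal.algebraMap_quotient_injective)
  have : Module.IsTorsionFree (A ⧸ P) (B ⧸ Q) := Module.isTorsionFree_iff_faithfulSMul.mpr this
  have : Module.IsTorsionFree (A ⧸ P) K := Module.isTorsionFree_iff_faithfulSMul.mpr ‹_›
  let ψ : B ⧸ Q →ₐ[A ⧸ P] K := IsAlgClosed.lift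
  refine ⟨(ψ.restrictScalars A).comp (Ideal.Quotient.mkₐ A Q), ?_⟩
  have hbot : RingHom.ker ψ = ⊥ := by
    refine Ideal.eq_bot_of_comap_eq_bot (R := A ⧸ P) ?_
    rw [eq_bot_iff]
    intro a ha
    rw [Ideal.mem_comap, RingHom.mem_ker, AlgHom.commutes] at ha
    exact hinj (by simpa using ha)
  ext b
  have : ψ (Ideal.Quotient.mk Q b) = 0 ↔ Ideal.Quotient.mk Q b = 0 := by
    rw [← RingHom.mem_ker, hbot, Ideal.mem_bot]
  simpa [Ideal.Quotient.eq_zero_iff_mem] using this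

/-- A monic polynomial over `A` splits after a flat base change `A → T` through which a given
geometric point `A → K` factors, where moreover `T` is local with maximal ideal the kernel of `T →
K`. -/
theorem exists_flat_splits {A K : Type u} [CommRing A] [Field K] [IsAlgClosed K] [Algebra A K]
    {f : A[X]} (hf : f.Monic) :
    ∃ (T : Type u) (_ : CommRing T) (_ : Algebra A T) (_ : Algebra T K)
      (_ : IsScalarTower A T K), Module.Flat A T ∧ IsLocalHom (algebraMap T K) ∧
      (f.map (algebraMap A T)).Splits := by
  have : Nontrivial A := (algebraMap A K).domain_nontrivial
  -- `T` is free over `A`; it is localized at a prime over the kernel of `A → K` below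
  obtain ⟨T, _, _, _, _, _, hT⟩ := hf.exists_splits_map
  have hprime : (RingHom.ker (algebraMap A K)).IsPrime := RingHom.ker_isPrime _
  obtain ⟨Q, -, hQ, hQP⟩ := Ideal.exists_ideal_over_prime_of_isIntegral (S := T)
    (RingHom.ker (algebraMap A K)) ⊥ (by
      intro a ha
      have : a = 0 := FaithfulSMul.algebraMap_injective A T (by simpa using ha)
      simp [this])
  obtain ⟨ψ, hψ⟩ := exists_algHom_ker_eq Q hQP
  have hu : ∀ y : Q.primeCompl, IsUnit (ψ.toRingHom y) := fun y ↦ by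
    refine isUnit_iff_ne_zero.mpr fun h ↦ y.2 ?_
    exact hψ.le h
  let φ : Localization.AtPrime Q →+* K := IsLocalization.lift hu
  let : Algebra (Localization.AtPrime Q) K := φ.toAlgebra
  have hφ (t : T) : φ (algebraMap T _ t) = ψ t := IsLocalization.lift_eq hu t
  refine ⟨Localization.AtPrime Q, inferInstance, inferInstance, inferInstance,
    .of_algebraMap_eq fun a ↦ ?_, .trans A T _, ⟨fun t ht ↦ ?_⟩, ?_⟩
  · rw [IsScalarTower.algebraMap_apply A T (Localization.AtPrime Q)]
    exact ((hφ _).trans (ψ.commutes a)).symm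
  · obtain ⟨x, y, rfl⟩ := IsLocalization.exists_mk'_eq Q.primeCompl t
    have hx : ψ x ≠ 0 := by
      rintro h
      refine ht.ne_zero ?_
      change φ _ = 0
      rw [← (hu y).mul_left_eq_zero]
      change φ _ * ψ y = 0
      rw [← hφ, ← map_mul, IsLocalization.mk'_spec, hφ, h]
    have h := IsLocalization.map_units (Localization.AtPrime Q)
      (⟨x, fun h ↦ hx (hψ.ge h)⟩ : Q.primeCompl)
    rw [← IsLocalization.mk'_spec (Localization.AtPrime Q) x y] at h
    exact isUnit_of_mul_isUnit_left h
  · rw [IsScalarTower.algebraMap_eq A T, ← Polynomial.map_map]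
    exact hT.map _

/-- Idempotents of an integral algebra over a local ring are determined by their values at the
geometric points over the closed point. -/
theorem IsIdempotentElem.eq_of_forall_algHom {T D K : Type*} [CommRing T] [CommRing D]
    [Algebra T D] [Algebra.IsIntegral T D] [Field K] [IsAlgClosed K] [Algebra T K]
    [IsLocalHom (algebraMap T K)] {e f : D} (he : IsIdempotentElem e) (hf : IsIdempotentElem f)
    (h : ∀ ψ : D →ₐ[T] K, ψ e = ψ f) : e = f := by
  have hJ : e - f ∈ Ideal.jacobson (⊥ : Ideal D) := by
    rw [Ideal.jacobson, Submodule.mem_sInf]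
    rintro M ⟨-, hM⟩
    have hmax : Ideal.IsMaximal (Ideal.comap (algebraMap T D) M) :=
      Ideal.isMaximal_comap_of_isIntegral_of_isMaximal M
    obtain ⟨ψ, hψ⟩ := exists_algHom_ker_eq (K := K) M <| by
      refine hmax.eq_of_le (RingHom.ker_ne_top _) fun t ht ↦ ?_
      by_contra hne
      have : IsUnit t := isUnit_of_map_unit (algebraMap T K) t (isUnit_iff_ne_zero.mpr hne)
      exact hmax.ne_top (Ideal.eq_top_of_isUnit_mem _ ht this)
    rw [← hψ]
    change ψ (e - f) = 0
    rw [map_sub, h, sub_self]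
  -- the difference `d` of two idempotents satisfies `d ^ 3 = d`, so it vanishes once `1 - d ^ 2` is
  -- a unit
  have hunit : IsUnit ((e - f) * (-(e - f)) + 1) := Ideal.mem_jacobson_bot.mp hJ _
  have h0 : ((e - f) * (-(e - f)) + 1) * (e - f) = 0 := by
    have he' : e * e = e := he
    have hf' : f * f = f := hf
    linear_combination (-(e) + 3 * f - 1) * he' - (3 * e - f - 1) * hf'
  exact sub_eq_zero.mp (hunit.mul_right_eq_zero.mp h0)

theorem isCoprime_multisetProd {R : Type*} [CommRing R] {s : Multiset R} {x : R}
    (h : ∀ y ∈ s, IsCoprime y x) : IsCoprime s.prod x := by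
  induction s using Multiset.induction with
  | empty => simpa using isCoprime_one_left
  | cons a s ih =>
    rw [Multiset.prod_cons]
    exact (h a (Multiset.mem_cons_self a s)).mul_left
      (ih fun y hy ↦ h y (Multiset.mem_cons_of_mem hy))

/-- If `b` is a root of a monic polynomial that splits over the local ring `T`, some idempotent
separates the geometric points at which `b` takes the value `c` from the others. Grouping the linear
factors by whether their root reduces to `c` writes the polynomial as a product of two coprime ones,
and the idempotent is read off from the Bézout identity. -/
theorem exists_isIdempotentElem_algHom_apply_eq {T D K : Type*} [CommRing T] [CommRing D]
    [Algebra T D] [Field K] [Algebra T K] [IsLocalHom (algebraMap T K)] {f : T[X]} (hf : f.Monic)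
    (hs : f.Splits) {b : D} (hb : aeval b f = 0) (c : K) :
    ∃ e : D, IsIdempotentElem e ∧
      ∀ ψ : D →ₐ[T] K, (ψ b = c → ψ e = 1) ∧ (ψ b ≠ c → ψ e = 0) := by
  classical
  obtain ⟨m, hm⟩ := splits_iff_exists_multiset.mp hs
  rw [hf.leadingCoeff, C_1, one_mul] at hm
  let m₁ := m.filter (fun a ↦ algebraMap T K a = c)
  let m₂ := m.filter (fun a ↦ ¬ algebraMap T K a = c)
  let g : T[X] := (m₁.map fun a ↦ X - C a).prod
  let h : T[X] := (m₂.map fun a ↦ X - C a).prod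
  have hfgh : f = g * h := by
    rw [hm, ← Multiset.prod_add, ← Multiset.map_add, Multiset.filter_add_not]
  have hcop : IsCoprime g h := by
    refine isCoprime_multisetProd fun p hp ↦ (isCoprime_multisetProd fun q hq ↦ ?_).symm
    obtain ⟨a, ha, rfl⟩ := Multiset.mem_map.mp hp
    obtain ⟨a', ha', rfl⟩ := Multiset.mem_map.mp hq
    refine (isCoprime_X_sub_C_of_isUnit_sub ?_).symm
    refine isUnit_of_map_unit (algebraMap T K) _ (isUnit_iff_ne_zero.mpr ?_)
    rw [map_sub, (Multiset.mem_filter.mp ha).2, sub_ne_zero]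
    exact fun h ↦ (Multiset.mem_filter.mp ha').2 h.symm
  obtain ⟨u, v, huv⟩ := hcop
  have hgh : aeval b g * aeval b h = 0 := by rw [← map_mul, ← hfgh, hb]
  have huv' : aeval b u * aeval b g + aeval b v * aeval b h = 1 := by
    rw [← map_mul, ← map_mul, ← map_add, huv, map_one]
  refine ⟨aeval b v * aeval b h, ?_, fun ψ ↦ ⟨fun hψ ↦ ?_, fun hψ ↦ ?_⟩⟩
  · change _ * _ = _
    linear_combination (-aeval b u * aeval b v) * hgh + aeval b v * aeval b h * huv'
  · -- `c` is no root of `h`, so `g` vanishes at `c`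
    have h0 : ψ (aeval b g) = 0 := by
      have hne : ψ (aeval b h) ≠ 0 := by
        rw [← aeval_algHom_apply, hψ, map_multiset_prod, Multiset.map_map]
        refine Multiset.prod_ne_zero fun hmem ↦ ?_
        obtain ⟨a, ha, ha0⟩ := Multiset.mem_map.mp hmem
        refine (Multiset.mem_filter.mp ha).2 ?_
        simpa [sub_eq_zero, eq_comm (a := c)] using ha0
      exact (mul_eq_zero.mp (by rw [← map_mul, hgh, map_zero])).resolve_right hne
    have := congr(ψ $huv')
    rwa [map_add, map_mul, h0, mul_zero, zero_add, map_one] at this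
  · have hne : ψ (aeval b g) ≠ 0 := by
      rw [← aeval_algHom_apply, map_multiset_prod, Multiset.map_map]
      refine Multiset.prod_ne_zero fun hmem ↦ ?_
      obtain ⟨a, ha, ha0⟩ := Multiset.mem_map.mp hmem
      refine hψ (Eq.trans ?_ (Multiset.mem_filter.mp ha).2)
      simpa [sub_eq_zero] using ha0
    have h0 : ψ (aeval b h) = 0 :=
      (mul_eq_zero.mp (by rw [← map_mul, hgh, map_zero])).resolve_left hne
    rw [map_mul, h0, mul_zero]

/-- The restriction to `B` of a `K`-point of `T ⊗[A] B` over `T`. -/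
def restrictRight {A T B K : Type*} [CommRing A] [CommRing T] [CommRing B] [Field K] [Algebra A T]
    [Algebra A B] [Algebra T K] [Algebra A K] [IsScalarTower A T K] (ψ : T ⊗[A] B →ₐ[T] K) :
    B →ₐ[A] K :=
  (ψ.restrictScalars A).comp Algebra.TensorProduct.includeRight

/-- After a flat base change to a local ring `T`, every set `O` of geometric points of a finite
algebra `B` over a fixed geometric point of `A` is cut out by an idempotent of `T ⊗[A] B`. -/
theorem exists_flat_isIdempotentElem {A B K : Type u} [CommRing A] [CommRing B] [Field K]
    [IsAlgClosed K] [Algebra A B] [Module.Finite A B] [Algebra A K] (O : Set (B →ₐ[A] K)) :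
    ∃ (T : Type u) (_ : CommRing T) (_ : Algebra A T) (_ : Algebra T K)
      (_ : IsScalarTower A T K) (e : T ⊗[A] B), Module.Flat A T ∧ IsLocalHom (algebraMap T K) ∧
      IsIdempotentElem e ∧ ∀ ψ : T ⊗[A] B →ₐ[T] K,
        (restrictRight ψ ∈ O → ψ e = 1) ∧ (restrictRight ψ ∉ O → ψ e = 0) := by
  classical
  obtain ⟨s, hs⟩ := Module.Finite.fg_top (R := A) (M := B)
  have hmonic : (∏ b ∈ s, minpoly A b).Monic :=
    monic_prod_of_monic _ _ fun b _ ↦ minpoly.monic (Algebra.IsIntegral.isIntegral b)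
  obtain ⟨T, _, _, _, _, hflat, hloc, hsplit⟩ := exists_flat_splits (K := K) hmonic
  have key (b : B) (hb : b ∈ s) (c : K) : ∃ e : T ⊗[A] B, IsIdempotentElem e ∧
      ∀ ψ : T ⊗[A] B →ₐ[T] K,
        (restrictRight ψ b = c → ψ e = 1) ∧ (restrictRight ψ b ≠ c → ψ e = 0) := by
    refine exists_isIdempotentElem_algHom_apply_eq (b := (1 : T) ⊗ₜ[A] b)
      (hmonic.map (algebraMap A T)) hsplit ?_ c
    have h0 : aeval b (∏ b ∈ s, minpoly A b) = 0 := by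
      rw [map_prod]
      exact Finset.prod_eq_zero hb (minpoly.aeval A b)
    rw [aeval_map_algebraMap]
    change aeval (Algebra.TensorProduct.includeRight (R := A) (A := T) b) _ = 0
    rw [aeval_algHom_apply, h0, map_zero]
  choose! e he hψe using key
  -- the idempotent of the single point `x`; those of the points of `O` are joined below
  let e' (x : B →ₐ[A] K) : T ⊗[A] B := ∏ b ∈ s, e b (x b)
  have he' (x) : IsIdempotentElem (e' x) := by
    change _ * _ = _
    rw [← Finset.prod_mul_distrib]
    exact Finset.prod_congr rfl fun b hb ↦ he b hb _
  have hψe' (x) (ψ : T ⊗[A] B →ₐ[T] K) :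
      (restrictRight ψ = x → ψ (e' x) = 1) ∧ (restrictRight ψ ≠ x → ψ (e' x) = 0) := by
    refine ⟨fun h ↦ ?_, fun h ↦ ?_⟩
    · rw [map_prod]
      exact Finset.prod_eq_one fun b hb ↦ (hψe b hb _ ψ).1 (by rw [h])
    · obtain ⟨b, hb, hne⟩ : ∃ b ∈ s, restrictRight ψ b ≠ x b := by
        by_contra! hall
        exact h (AlgHom.toLinearMap_injective
          (LinearMap.ext_on hs (f := (restrictRight ψ).toLinearMap) (g := x.toLinearMap) hall))
      rw [map_prod]
      exact Finset.prod_eq_zero hb ((hψe b hb _ ψ).2 hne)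
  have hfin : O.Finite := Set.toFinite O
  refine ⟨T, _, _, _, ‹_›, 1 - ∏ x ∈ hfin.toFinset, (1 - e' x), hflat, hloc,
    IsIdempotentElem.one_sub ?_, fun ψ ↦ ⟨fun h ↦ ?_, fun h ↦ ?_⟩⟩
  · change _ * _ = _
    rw [← Finset.prod_mul_distrib]
    exact Finset.prod_congr rfl fun x _ ↦ (he' x).one_sub
  · rw [map_sub, map_one, map_prod, Finset.prod_eq_zero (hfin.mem_toFinset.mpr h), sub_zero]
    rw [map_sub, map_one, (hψe' _ ψ).1 rfl, sub_self]
  · rw [map_sub, map_one, map_prod, Finset.prod_eq_one, sub_self]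
    intro x hx
    rw [map_sub, map_one, (hψe' _ ψ).2, sub_zero]
    rintro rfl
    exact h (hfin.mem_toFinset.mp hx)

/-- Let `B ⇉ C` be a pair of `A`-algebra homomorphisms whose equalizer is the image of `A`. If it
induces an equivalence relation on the points of `B` over a geometric point of `A`, all these points
are equivalent: after a flat base change, the idempotent that cuts out one class is invariant, hence
comes from the base, hence is constant on the fibre. -/
theorem exists_algHom_comp_eq_of_equivalence {A B C K : Type u} [CommRing A] [CommRing B]
    [CommRing C] [Field K] [IsAlgClosed K] [Algebra A B] [Algebra A C] [Algebra A K]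
    [Module.Finite A B] [Algebra.IsIntegral A C] (p₁ p₂ : B →ₐ[A] C)
    (hA : ∀ b, p₁ b = p₂ b → b ∈ (algebraMap A B).range)
    (h : Equivalence fun x x' : B →ₐ[A] K ↦ ∃ r : C →ₐ[A] K, r.comp p₁ = x ∧ r.comp p₂ = x')
    (x x' : B →ₐ[A] K) : ∃ r : C →ₐ[A] K, r.comp p₁ = x ∧ r.comp p₂ = x' := by
  obtain ⟨T, _, _, _, _, e, hflat, hloc, he, hψe⟩ := exists_flat_isIdempotentElem (A := A)
    {y : B →ₐ[A] K | ∃ r : C →ₐ[A] K, r.comp p₁ = x ∧ r.comp p₂ = y}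
  let P₁ : T ⊗[A] B →ₐ[T] T ⊗[A] C := Algebra.TensorProduct.map (.id T T) p₁
  let P₂ : T ⊗[A] B →ₐ[T] T ⊗[A] C := Algebra.TensorProduct.map (.id T T) p₂
  -- a class contains one end of each related pair exactly when it contains the other
  have hP : P₁ e = P₂ e := by
    refine IsIdempotentElem.eq_of_forall_algHom (T := T) (K := K) (he.map P₁) (he.map P₂)
      fun ψ ↦ ?_
    have hrel : ∃ r : C →ₐ[A] K, r.comp p₁ = restrictRight (ψ.comp P₁) ∧
        r.comp p₂ = restrictRight (ψ.comp P₂) :=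
      ⟨restrictRight ψ, by ext b; simp [restrictRight, P₁], by ext b; simp [restrictRight, P₂]⟩
    by_cases hx : ∃ r : C →ₐ[A] K, r.comp p₁ = x ∧ r.comp p₂ = restrictRight (ψ.comp P₁)
    · exact ((hψe (ψ.comp P₁)).1 hx).trans ((hψe (ψ.comp P₂)).1 (h.trans hx hrel)).symm
    · exact ((hψe (ψ.comp P₁)).2 hx).trans
        ((hψe (ψ.comp P₂)).2 fun hx' ↦ hx (h.trans hx' (h.symm hrel))).symm
  -- by flatness, the equalizer of `P₁` and `P₂` is the image of `T`
  obtain ⟨t, ht⟩ : ∃ t : T, algebraMap T (T ⊗[A] B) t = e := by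
    have hex : Function.Exact (Algebra.linearMap A B) (p₁.toLinearMap - p₂.toLinearMap) := by
      intro b
      refine ⟨fun hb ↦ hA b (sub_eq_zero.mp hb), ?_⟩
      rintro ⟨a, rfl⟩
      simp
    obtain ⟨y, hy⟩ := (Module.Flat.lTensor_exact T hex e).mp <| by
      rw [LinearMap.lTensor_sub]
      exact sub_eq_zero.mpr hP
    refine ⟨TensorProduct.rid A T y, ?_⟩
    rw [← hy]
    clear hy
    induction y with
    | zero => simp
    | add y z hy hz => rw [map_add, map_add, map_add, hy, hz]
    | tmul t a =>
      rw [TensorProduct.rid_tmul, LinearMap.lTensor_tmul, Algebra.linearMap_apply,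
        Algebra.algebraMap_eq_smul_one a, ← TensorProduct.smul_tmul,
        Algebra.TensorProduct.algebraMap_apply]
      rfl
  let ψ (y : B →ₐ[A] K) : T ⊗[A] B →ₐ[T] K :=
    Algebra.TensorProduct.lift (Algebra.ofId T K) y fun _ _ ↦ .all _ _
  have hψ (y) : restrictRight (ψ y) = y := by ext b; simp [restrictRight, ψ]
  have h1 : algebraMap T K t = 1 := by
    rw [← (hψe (ψ x)).1 (by rw [hψ]; exact h.refl x), ← ht, AlgHom.commutes]
  by_contra hx'
  have h0 : algebraMap T K t = 0 := by
    rw [← (hψe (ψ x')).2 (by rw [hψ]; exact hx'), ← ht, AlgHom.commutes]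
  exact one_ne_zero (h1.symm.trans h0)

end Algebra

/-! ### The relative spectrum of the kernel -/

section SpecKernel

/-- Forming the equalizer of two ring homomorphisms commutes with localization at an element of
the equalizer. -/
theorem isLocalizationAway_eqLocus {B B' C C' : Type*} [CommRing B] [CommRing B'] [CommRing C]
    [CommRing C'] [Algebra B B'] [Algebra C C'] {p q : B →+* C} {p' q' : B' →+* C'}
    (hp : ∀ b, p' (algebraMap B B' b) = algebraMap C C' (p b))
    (hq : ∀ b, q' (algebraMap B B' b) = algebraMap C C' (q b)) (r : p.eqLocus q)
    [IsLocalization.Away (r : B) B'] [IsLocalization.Away (p r) C']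
    [Algebra (p.eqLocus q) (p'.eqLocus q')]
    (h : ∀ a : p.eqLocus q, (algebraMap (p.eqLocus q) (p'.eqLocus q') a : B') =
      algebraMap B B' a) :
    IsLocalization.Away r (p'.eqLocus q') := by
  have hmem (a : p.eqLocus q) : p a = q a := a.2
  -- the inverse of `r` in `B'` is again in the equalizer
  obtain ⟨u, hu⟩ := (IsLocalization.Away.algebraMap_isUnit (r : B) (S := B')).exists_right_inv
  have hpu : p' u = q' u := by
    have h1 : algebraMap C C' (p r) * p' u = 1 := by rw [← hp, ← map_mul, hu, map_one]
    have h2 : algebraMap C C' (p r) * q' u = 1 := by rw [hmem, ← hq, ← map_mul, hu, map_one]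
    linear_combination (q' u) * h1 - (p' u) * h2
  refine IsLocalization.Away.mk (r := r) ?_ ?_ ?_
  · exact IsUnit.of_mul_eq_one ⟨u, hpu⟩ (Subtype.ext (by simp [h, hu]))
  · intro z
    obtain ⟨n, b, hb⟩ := IsLocalization.Away.surj (r : B) (z : B')
    have hz : p' (z : B') = q' z := z.2
    have hpb : algebraMap C C' (p b) = algebraMap C C' (q b) := by
      rw [← hp, ← hq, ← hb, map_mul, map_mul, hz, map_pow, map_pow, hp, hq, hmem]
    obtain ⟨m, hm⟩ := IsLocalization.Away.exists_of_eq (p r) hpb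
    -- multiplying by a further power of `r` makes the numerator itself lie in the equalizer
    refine ⟨n + m, ⟨r ^ m * b, ?_⟩, Subtype.ext ?_⟩
    · change p _ = q _
      rw [map_mul, map_mul, map_pow, map_pow, hm, hmem]
    · simp only [Subring.coe_mul, Subring.coe_pow, h, map_mul, map_pow, ← hb]
      ring
  · intro a b hab
    have hab' : algebraMap B B' a = algebraMap B B' b := by rw [← h, ← h, hab]
    obtain ⟨m, hm⟩ := IsLocalization.Away.exists_of_eq (r : B) hab'
    exact ⟨m, Subtype.ext hm⟩

variable {S : Scheme.{u}} {X R : Over S}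

/-- The restriction of sections of the direct image on `S` of the structure sheaf of `X`. -/
def restrictSections (X : Over S) {U V : S.Opens} (h : V ≤ U) :
    sectionsOver X U →+* sectionsOver X V :=
  (X.left.presheaf.map (homOfLE (X.hom.preimage_mono h)).op).hom

theorem pullbackSections_restrictSections {X Y : Over S} (f : X ⟶ Y) {U V : S.Opens} (h : V ≤ U)
    (a : sectionsOver Y U) :
    pullbackSections f V (restrictSections Y h a) =
      restrictSections X h (pullbackSections f U a) := by
  simp only [pullbackSections, restrictSections, ← CommRingCat.comp_apply, Scheme.Hom.map_appLE,
    Scheme.Hom.appLE_map]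

theorem pullbackSections_comp {X Y Z : Over S} (f : X ⟶ Y) (g : Y ⟶ Z) (U : S.Opens) :
    pullbackSections (f ≫ g) U = (pullbackSections f U).comp (pullbackSections g U) := by
  simp only [pullbackSections, ← CommRingCat.hom_comp, Scheme.Hom.appLE_comp_appLE, Over.comp_left]

theorem pullbackSections_app {X Y : Over S} (f : X ⟶ Y) (U : S.Opens) (a : Γ(S, U)) :
    pullbackSections f U (Y.hom.app U a) = X.hom.app U a := by
  simp only [pullbackSections, ← CommRingCat.comp_apply, Scheme.Hom.app_eq_appLE,
    Scheme.Hom.appLE_comp_appLE, Over.w]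

theorem restrictSections_app (X : Over S) {U V : S.Opens} (h : V ≤ U) (a : Γ(S, U)) :
    restrictSections X h (X.hom.app U a) = X.hom.app V (S.presheaf.map (homOfLE h).op a) := by
  simp only [restrictSections, ← CommRingCat.comp_apply, Scheme.Hom.app_eq_appLE,
    Scheme.Hom.appLE_map, Scheme.Hom.map_appLE]

variable (p₁ p₂ : R ⟶ X)

/-- The sections over `U` of the kernel of `p₁^* - p₂^*`, as a subring of `Γ(X, U)`. -/
abbrev kernelSections (U : S.Opens) : Subring (sectionsOver X U) :=
  (pullbackSections p₁ U).eqLocus (pullbackSections p₂ U)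

/-- The restriction maps of the kernel of `p₁^* - p₂^*`. -/
def restrictKernel {U V : S.Opens} (h : V ≤ U) :
    kernelSections p₁ p₂ U →+* kernelSections p₁ p₂ V :=
  (restrictSections X h).restrict _ _ fun a ha ↦ by
    change pullbackSections p₁ _ _ = pullbackSections p₂ _ _
    rw [pullbackSections_restrictSections, pullbackSections_restrictSections]
    exact congrArg _ ha

/-- The presheaf of rings `ker [p₁^* - p₂^* : 𝒪_X ⟶ 𝒪_R]` on `S`. -/
def kernelDiagram : S.Opensᵒᵖ ⥤ CommRingCat.{u} where
  obj U := .of (kernelSections p₁ p₂ U.unop)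
  map i := CommRingCat.ofHom (restrictKernel p₁ p₂ i.unop.le)
  map_id U := by
    ext a
    change (X.left.presheaf.map (𝟙 _)) a.1 = _
    simp
  map_comp i j := by
    ext a
    change X.left.presheaf.map _ a.1 = X.left.presheaf.map _ (X.left.presheaf.map _ a.1)
    rw [← CommRingCat.comp_apply, ← X.left.presheaf.map_comp]
    rfl

/-- The structure map of the kernel of `p₁^* - p₂^*` as an algebra over the structure sheaf. -/
def kernelAlgebraMap (U : S.Opens) : Γ(S, U) →+* kernelSections p₁ p₂ U :=
  (X.hom.app U).hom.codRestrict (kernelSections p₁ p₂ U) fun a ↦ by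
    change pullbackSections p₁ _ _ = pullbackSections p₂ _ _
    exact (pullbackSections_app p₁ _ a).trans (pullbackSections_app p₂ _ a).symm

/-- The structure map of the kernel as a presheaf of `𝒪_S`-algebras. -/
def kernelDiagramMap : S.presheaf ⟶ kernelDiagram p₁ p₂ where
  app U := CommRingCat.ofHom (kernelAlgebraMap p₁ p₂ U.unop)
  naturality {U V} i := by
    ext a
    refine Subtype.ext ?_
    exact (restrictSections_app X i.unop.le a).symm

open Scheme Scheme.AffineZariskiSite

/-- Morphisms defined on the preimages of the affine opens of `S` glue if they are compatible with
passing to basic opens. -/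
theorem exists_hom_of_isAffineOpen {X S Y : Scheme.{u}} (f : X ⟶ S)
    (g : ∀ {U : S.Opens}, IsAffineOpen U → ((f ⁻¹ᵁ U).toScheme ⟶ Y))
    (h : ∀ {U V : S.Opens} (hU : IsAffineOpen U) (hV : IsAffineOpen V) (hUV : U ≤ V),
      (∃ r : Γ(S, V), S.basicOpen r = U) →
        X.homOfLE (f.preimage_mono hUV) ≫ g hV = g hU) :
    ∃ q : X ⟶ Y, ∀ {U : S.Opens} (hU : IsAffineOpen U), (f ⁻¹ᵁ U).ι ≫ q = g hU := by
  let e (U : ((directedCover S).pullback₁ f).I₀) :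
      ((directedCover S).pullback₁ f).X U ≅ (f ⁻¹ᵁ U.1).toScheme :=
    pullbackRestrictIsoRestrict f U.1
  have he (U : ((directedCover S).pullback₁ f).I₀) :
      (e U).hom ≫ (f ⁻¹ᵁ U.1).ι = ((directedCover S).pullback₁ f).f U :=
    pullbackRestrictIsoRestrict_hom_ι f U.1
  have hg {U V : ((directedCover S).pullback₁ f).I₀} (i : U ⟶ V) :
      Cover.trans ((directedCover S).pullback₁ f) i ≫ (e V).hom ≫ g V.2 =
        (e U).hom ≫ g U.2 := by
    have hle := CategoryTheory.leOfHom (X := S.AffineZariskiSite) i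
    have hi : U.1 ≤ V.1 := toOpens_mono (X := S) hle
    have htrans : Cover.trans ((directedCover S).pullback₁ f) i ≫ (e V).hom =
        (e U).hom ≫ X.homOfLE (f.preimage_mono hi) := by
      rw [← cancel_mono (f ⁻¹ᵁ V.1).ι, Category.assoc, Category.assoc, he V, homOfLE_ι, he U]
      exact Cover.trans_map ((directedCover S).pullback₁ f) i
    rw [← Category.assoc, htrans, Category.assoc, h U.2 V.2 hi hle]
  have hq (U : ((directedCover S).pullback₁ f).I₀) : (f ⁻¹ᵁ U.1).ι ≫
      OpenCover.glueMorphismsOfLocallyDirected ((directedCover S).pullback₁ f)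
        (fun U ↦ (e U).hom ≫ g U.2) hg = g U.2 := by
    rw [← cancel_epi (e U).hom, ← Category.assoc, he]
    exact OpenCover.map_glueMorphismsOfLocallyDirected ((directedCover S).pullback₁ f) _ hg U
  exact ⟨_, fun hU ↦ hq ⟨_, hU⟩⟩

theorem isLocalizationAway_restrictSections (X : Over S) [IsAffineHom X.hom] {U : S.Opens}
    (hU : IsAffineOpen U) (r : Γ(S, U)) :
    letI := (restrictSections X (S.basicOpen_le r)).toAlgebra
    IsLocalization.Away (X.hom.app U r) (sectionsOver X (S.basicOpen r)) := by
  exact (hU.preimage X.hom).isLocalization_of_eq_basicOpen (X.hom.app U r)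
    (homOfLE (X.hom.preimage_mono (S.basicOpen_le r))) (X.hom.preimage_basicOpen r)

variable [IsAffineHom X.hom] [IsAffineHom R.hom]

/-- The kernel is quasi-coherent: on affine opens, restriction to a basic open is localization. This
is the input for gluing the spectra of its rings of sections. -/
theorem coequifibered_kernelDiagramMap :
    ((toOpensFunctor S).op.whiskerLeft (kernelDiagramMap p₁ p₂)).Coequifibered := by
  refine coequifibered_iff_forall_isLocalizationAway.mpr fun U r ↦ ?_
  let := (restrictSections X (S.basicOpen_le r)).toAlgebra
  let := (restrictSections R (S.basicOpen_le r)).toAlgebra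
  let : Algebra (kernelSections p₁ p₂ U.1) (kernelSections p₁ p₂ (S.basicOpen r)) :=
    ((kernelDiagram p₁ p₂).map (homOfLE (S.basicOpen_le r)).op).hom.toAlgebra
  let r' : kernelSections p₁ p₂ U.1 := (kernelDiagramMap p₁ p₂).app (.op U.1) r
  have : IsLocalization.Away (r' : sectionsOver X U.1) (sectionsOver X (S.basicOpen r)) :=
    isLocalizationAway_restrictSections X U.2 r
  have := isLocalizationAway_restrictSections R U.2 r
  have : IsLocalization.Away (pullbackSections p₁ U.1 r') (sectionsOver R (S.basicOpen r)) := by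
    change IsLocalization.Away (pullbackSections p₁ U.1 (X.hom.app U.1 r)) _
    rwa [pullbackSections_app]
  exact isLocalizationAway_eqLocus (B := sectionsOver X U.1) (C := sectionsOver R U.1)
    (B' := sectionsOver X (S.basicOpen r)) (C' := sectionsOver R (S.basicOpen r))
    (fun b ↦ pullbackSections_restrictSections p₁ _ b)
    (fun b ↦ pullbackSections_restrictSections p₂ _ b) r' fun _ ↦ rfl

/-- The gluing data of the relative spectrum of the kernel. -/
def kernelGlueData := relativeGluingData (coequifibered_kernelDiagramMap p₁ p₂)

instance : ((kernelGlueData p₁ p₂).functor ⋙ Scheme.forget).IsLocallyDirected :=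
  Cover.RelativeGluingData.instIsLocallyDirectedI₀CompFunctorForgetOfIsThin ..

/-- The relative spectrum of the kernel. -/
def specKernel : Scheme.{u} := (kernelGlueData p₁ p₂).glued

/-- The structure morphism of the relative spectrum. -/
def specKernelToBase : specKernel p₁ p₂ ⟶ S := (kernelGlueData p₁ p₂).toBase

variable {U V : S.Opens} (hU : IsAffineOpen U) (hV : IsAffineOpen V)

/-- The chart of the relative spectrum over an affine open `U ⊆ S`. -/
def kernelChart : Spec (.of (kernelSections p₁ p₂ U)) ⟶ specKernel p₁ p₂ :=
  (kernelGlueData p₁ p₂).cover.f ⟨U, hU⟩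

instance : IsOpenImmersion (kernelChart p₁ p₂ hU) :=
  (kernelGlueData p₁ p₂).cover.map_prop ⟨U, hU⟩

/-- The charts are compatible with restriction to basic opens. They are compatible with all
inclusions of affine opens, but the gluing data has transition maps only for basic opens. -/
lemma specMap_restrictKernel_kernelChart (hUV : U ≤ V) (h : ∃ r : Γ(S, V), S.basicOpen r = U) :
    Spec.map (CommRingCat.ofHom (restrictKernel p₁ p₂ hUV)) ≫ kernelChart p₁ p₂ hV =
      kernelChart p₁ p₂ hU := by
  let U' : S.AffineZariskiSite := ⟨U, hU⟩
  let V' : S.AffineZariskiSite := ⟨V, hV⟩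
  let i : U' ⟶ V' := homOfLE h
  exact colimit.w (kernelGlueData p₁ p₂).functor i

lemma kernelChart_specKernelToBase :
    kernelChart p₁ p₂ hU ≫ specKernelToBase p₁ p₂ =
      Spec.map (CommRingCat.ofHom (kernelAlgebraMap p₁ p₂ U)) ≫ hU.fromSpec :=
  colimit.ι_desc _ _

lemma specKernelToBase_preimage :
    specKernelToBase p₁ p₂ ⁻¹ᵁ U = (kernelChart p₁ p₂ hU).opensRange := by
  have h := (kernelGlueData p₁ p₂).toBase_preimage_eq_opensRange_ι ⟨U, hU⟩
  have h' : ((directedCover S).f ⟨U, hU⟩).opensRange = U := Scheme.Opens.opensRange_ι U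
  rw [h'] at h
  exact h

/-- On the preimage of an affine open `U ⊆ S`, the canonical morphism is given by the inclusion of
the kernel into `Γ(X, U)`. -/
theorem exists_toSpecKernel :
    ∃ q : X.left ⟶ specKernel p₁ p₂, ∀ {U : S.Opens} (hU : IsAffineOpen U),
      (X.hom ⁻¹ᵁ U).ι ≫ q = (X.hom ⁻¹ᵁ U).toSpecΓ ≫
        Spec.map (CommRingCat.ofHom (kernelSections p₁ p₂ U).subtype) ≫ kernelChart p₁ p₂ hU := by
  refine exists_hom_of_isAffineOpen X.hom _ fun {U V} hU hV hUV h ↦ ?_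
  rw [← specMap_restrictKernel_kernelChart p₁ p₂ hU hV hUV h,
    ← Scheme.Opens.toSpecΓ_SpecMap_presheaf_map_assoc, ← Spec.map_comp_assoc,
    ← Spec.map_comp_assoc]
  rfl

/-- The canonical morphism to the relative spectrum of the kernel. -/
def toSpecKernel : X.left ⟶ specKernel p₁ p₂ := (exists_toSpecKernel p₁ p₂).choose

lemma ι_toSpecKernel :
    (X.hom ⁻¹ᵁ U).ι ≫ toSpecKernel p₁ p₂ = (X.hom ⁻¹ᵁ U).toSpecΓ ≫
      Spec.map (CommRingCat.ofHom (kernelSections p₁ p₂ U).subtype) ≫ kernelChart p₁ p₂ hU :=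
  (exists_toSpecKernel p₁ p₂).choose_spec hU

lemma toSpecKernel_specKernelToBase :
    toSpecKernel p₁ p₂ ≫ specKernelToBase p₁ p₂ = X.hom := by
  have key {U : S.Opens} (hU : IsAffineOpen U) : (X.hom ⁻¹ᵁ U).ι ≫ toSpecKernel p₁ p₂ ≫
      specKernelToBase p₁ p₂ = (X.hom ⁻¹ᵁ U).ι ≫ X.hom := by
    rw [← Category.assoc, ι_toSpecKernel p₁ p₂ hU, Category.assoc, Category.assoc,
      kernelChart_specKernelToBase, ← Spec.map_comp_assoc]
    change (X.hom ⁻¹ᵁ U).toSpecΓ ≫ Spec.map (X.hom.app _) ≫ hU.fromSpec = _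
    simp
  exact Scheme.Cover.hom_ext (X.left.openCoverOfIsOpenCover _
    (.comap (iSup_affineOpens_eq_top S) X.hom.base.1)) _ _ fun U ↦ key U.2

instance : IsAffineHom (specKernelToBase p₁ p₂) where
  isAffine_preimage U hU := by
    rw [specKernelToBase_preimage p₁ p₂ hU]
    exact isAffineOpen_opensRange _

/-- The `S`-scheme given by the relative spectrum of the kernel. -/
def overSpecKernel : Over S := Over.mk (specKernelToBase p₁ p₂)

/-- The canonical morphism to the relative spectrum of the kernel, as an `S`-morphism. -/
def overToSpecKernel : X ⟶ overSpecKernel p₁ p₂ :=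
  Over.homMk (toSpecKernel p₁ p₂) (toSpecKernel_specKernelToBase p₁ p₂)

/-- Over an affine open, the sections of the relative spectrum are identified with the kernel so
that pullback along the canonical morphism becomes the inclusion. -/
lemma exists_isIso_appLE_toSpecKernel (hU : IsAffineOpen U) (h : X.hom ⁻¹ᵁ U ≤
    toSpecKernel p₁ p₂ ⁻¹ᵁ specKernelToBase p₁ p₂ ⁻¹ᵁ U) :
    ∃ φ : Γ(specKernel p₁ p₂, specKernelToBase p₁ p₂ ⁻¹ᵁ U) ⟶ .of (kernelSections p₁ p₂ U),
      IsIso φ ∧ (toSpecKernel p₁ p₂).appLE _ _ h =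
        φ ≫ CommRingCat.ofHom (kernelSections p₁ p₂ U).subtype := by
  have hV := hU.preimage X.hom
  have hW : IsAffineOpen (specKernelToBase p₁ p₂ ⁻¹ᵁ U) := hU.preimage _
  let e := IsOpenImmersion.isoOfRangeEq (kernelChart p₁ p₂ hU) hW.fromSpec <| by
    rw [hW.range_fromSpec, specKernelToBase_preimage p₁ p₂ hU]
    rfl
  obtain ⟨φ, hφ⟩ := Spec.map_surjective e.hom
  have : IsIso (Spec.map φ) := hφ ▸ inferInstance
  have : IsIso φ := by
    rwa [isIso_SpecMap_iff, ← ConcreteCategory.isIso_iff_bijective] at this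
  refine ⟨φ, this, Spec.map_injective ?_⟩
  rw [← cancel_mono hW.fromSpec, hW.SpecMap_appLE_fromSpec _ hV, Spec.map_comp, Category.assoc,
    hφ, IsOpenImmersion.isoOfRangeEq_hom_fac, ← cancel_epi hV.isoSpec.hom, hV.isoSpec_hom,
    hV.toSpecΓ_fromSpec_assoc]
  exact ι_toSpecKernel p₁ p₂ hU

theorem pullbackSections_overToSpecKernel_injective (hU : IsAffineOpen U) :
    Function.Injective (pullbackSections (overToSpecKernel p₁ p₂) U) := by
  obtain ⟨φ, hφ, h⟩ := exists_isIso_appLE_toSpecKernel p₁ p₂ hU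
    (preimage_le (overToSpecKernel p₁ p₂) U)
  have h' : pullbackSections (overToSpecKernel p₁ p₂) U =
    (kernelSections p₁ p₂ U).subtype.comp φ.hom := congr(($h).hom)
  rw [h']
  exact Subtype.val_injective.comp (ConcreteCategory.bijective_of_isIso φ).1

theorem range_pullbackSections_overToSpecKernel (hU : IsAffineOpen U) :
    (pullbackSections (overToSpecKernel p₁ p₂) U).range = kernelSections p₁ p₂ U := by
  obtain ⟨φ, hφ, h⟩ := exists_isIso_appLE_toSpecKernel p₁ p₂ hU
    (preimage_le (overToSpecKernel p₁ p₂) U)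
  have h' : pullbackSections (overToSpecKernel p₁ p₂) U =
    (kernelSections p₁ p₂ U).subtype.comp φ.hom := congr(($h).hom)
  rw [h']
  ext a
  refine ⟨?_, fun ha ↦ ?_⟩
  · rintro ⟨y, rfl⟩
    exact (φ.hom y).2
  · obtain ⟨y, hy⟩ := (ConcreteCategory.bijective_of_isIso φ).2 ⟨a, ha⟩
    exact ⟨y, congrArg Subtype.val hy⟩

end SpecKernel

/-! ### The structure sheaf of the relative spectrum -/

section StructureSheaf

variable {S : Scheme.{u}} {X R : Over S} (p₁ p₂ : R ⟶ X)

/-- Over the open `U ⊆ S`, the structure sheaf of `S` maps isomorphically onto the kernel of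
`p₁^* - p₂^*`. It is applied with the quotient in the place of `S`. -/
structure IsKernelOn (U : S.Opens) : Prop where
  injective : Function.Injective (X.hom.app U)
  exists_app_eq : ∀ a ∈ kernelSections p₁ p₂ U, ∃ t, X.hom.app U t = a

variable {p₁ p₂}

/-- Both the structure sheaf and the kernel are sheaves, so their agreement can be checked on a
basis. -/
theorem isKernelOn_of_basis
    (h : ∀ (V : S.Opens) (s : S), s ∈ V → ∃ W ≤ V, s ∈ W ∧ IsKernelOn p₁ p₂ W) (U : S.Opens) :
    IsKernelOn p₁ p₂ U := by
  have hinj (U : S.Opens) : Function.Injective (X.hom.app U) := by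
    intro t t' htt'
    refine S.IsSheaf.section_ext fun s hs ↦ ?_
    obtain ⟨W, hWU, hsW, hW⟩ := h U s hs
    refine ⟨W, hWU, hsW, hW.injective ?_⟩
    exact (restrictSections_app X hWU t).symm.trans
      ((congrArg _ htt').trans (restrictSections_app X hWU t'))
  refine ⟨hinj U, fun a ha ↦ ?_⟩
  choose W hWU hsW hW using fun s : U ↦ h U s s.2
  have hmem (s : U) : restrictSections X (hWU s) a ∈ kernelSections p₁ p₂ (W s) := by
    change pullbackSections p₁ _ _ = pullbackSections p₂ _ _
    rw [pullbackSections_restrictSections, pullbackSections_restrictSections]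
    exact congrArg _ ha
  choose t ht using fun s : U ↦ (hW s).exists_app_eq _ (hmem s)
  have hcover : U ≤ iSup W := fun s hs ↦
    TopologicalSpace.Opens.mem_iSup.mpr ⟨⟨s, hs⟩, hsW ⟨s, hs⟩⟩
  obtain ⟨t₀, ht₀, -⟩ := S.sheaf.existsUnique_gluing' W U (fun s ↦ homOfLE (hWU s)) hcover t <| by
    intro s s'
    refine hinj _ ?_
    refine (restrictSections_app X inf_le_left (t s)).symm.trans
      (Eq.trans ?_ (restrictSections_app X inf_le_right (t s')))
    rw [ht, ht]
    simp only [restrictSections, ← CommRingCat.comp_apply, ← Functor.map_comp]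
    rfl
  refine ⟨t₀, ?_⟩
  refine X.left.IsSheaf.section_ext fun x hx ↦ ?_
  refine ⟨X.hom ⁻¹ᵁ W ⟨X.hom x, hx⟩, X.hom.preimage_mono (hWU _), hsW ⟨X.hom x, hx⟩, ?_⟩
  exact (restrictSections_app X (hWU _) t₀).trans
    ((congrArg _ (ht₀ ⟨X.hom x, hx⟩)).trans (ht ⟨X.hom x, hx⟩))

theorem IsKernelOn.basicOpen [IsAffineHom X.hom] [IsAffineHom R.hom] {U : S.Opens}
    (hU : IsAffineOpen U) (h : IsKernelOn p₁ p₂ U) (r : Γ(S, U)) :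
    IsKernelOn p₁ p₂ (S.basicOpen r) := by
  let := (restrictSections X (S.basicOpen_le r)).toAlgebra
  have := isLocalizationAway_restrictSections X hU r
  let := (restrictSections R (S.basicOpen_le r)).toAlgebra
  have := isLocalizationAway_restrictSections R hU r
  have := hU.isLocalization_basicOpen r
  let f := (kernelDiagramMap p₁ p₂).app (.op U)
  let g := (kernelDiagramMap p₁ p₂).app (.op (S.basicOpen r))
  have hf : IsIso f := by
    rw [ConcreteCategory.isIso_iff_bijective]
    refine ⟨fun a b hab ↦ h.injective congr(($hab).1), fun a ↦ ?_⟩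
    obtain ⟨t, ht⟩ := h.exists_app_eq _ a.2
    exact ⟨t, Subtype.ext ht⟩
  have hg : IsIso g := by
    have H := coequifibered_kernelDiagramMap p₁ p₂
      (homOfLE (Scheme.AffineZariskiSite.basicOpen_le ⟨U, hU⟩ r)).op
    have : IsIso (((Scheme.AffineZariskiSite.toOpensFunctor S).op.whiskerLeft
        (kernelDiagramMap p₁ p₂)).app (Opposite.op ⟨U, hU⟩)) := hf
    exact H.isIso_inl_of_isIso
  rw [ConcreteCategory.isIso_iff_bijective] at hg
  refine ⟨fun a b hab ↦ hg.1 (Subtype.ext hab), fun a ha ↦ ?_⟩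
  obtain ⟨t, ht⟩ := hg.2 ⟨a, ha⟩
  exact ⟨t, congrArg Subtype.val ht⟩

/-- A morphism to a scheme affine over `S` is determined by its effect on sections over affine
opens. -/
theorem hom_ext_of_pullbackSections {X Y : Over S} [IsAffineHom Y.hom] {f g : X ⟶ Y}
    (h : ∀ U : S.Opens, IsAffineOpen U → pullbackSections f U = pullbackSections g U) :
    f = g := by
  ext1
  refine Scheme.Cover.hom_ext (X.left.openCoverOfIsOpenCover _
    (.comap (iSup_affineOpens_eq_top S) X.hom.base.1)) _ _ fun U ↦ ?_
  have key (f : X ⟶ Y) : (X.hom ⁻¹ᵁ U.1).ι ≫ f.left = (X.hom ⁻¹ᵁ U.1).toSpecΓ ≫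
      Spec.map (CommRingCat.ofHom (pullbackSections f U.1)) ≫ (U.2.preimage Y.hom).fromSpec := by
    change _ = (X.hom ⁻¹ᵁ U.1).toSpecΓ ≫ Spec.map (f.left.appLE _ _ (preimage_le f U.1)) ≫ _
    simp
  exact (key f).trans (Eq.trans (by rw [h U.1 U.2]) (key g).symm)

theorem condition_overToSpecKernel [IsAffineHom X.hom] [IsAffineHom R.hom] :
    p₁ ≫ overToSpecKernel p₁ p₂ = p₂ ≫ overToSpecKernel p₁ p₂ := by
  have : IsAffineHom (overSpecKernel p₁ p₂).hom :=
    inferInstanceAs (IsAffineHom (specKernelToBase p₁ p₂))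
  refine hom_ext_of_pullbackSections fun U hU ↦ ?_
  ext a
  rw [pullbackSections_comp, pullbackSections_comp]
  have : pullbackSections (overToSpecKernel p₁ p₂) U a ∈ kernelSections p₁ p₂ U := by
    rw [← range_pullbackSections_overToSpecKernel p₁ p₂ hU]
    exact ⟨a, rfl⟩
  exact this

variable {Y : Over S} {q : X ⟶ Y}

/-- The first projection of `R ⇉ X`, as a morphism over a scheme `Y` on which the two composites
`R ⇉ X ⟶ Y` agree. -/
def fstOver (p₁ : R ⟶ X) (q : X ⟶ Y) : Over.mk (p₁ ≫ q).left ⟶ Over.mk q.left :=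
  Over.homMk p₁.left rfl

/-- The second projection of `R ⇉ X`, as a morphism over a scheme `Y` on which the two composites
`R ⇉ X ⟶ Y` agree. -/
def sndOver (w : p₁ ≫ q = p₂ ≫ q) : Over.mk (p₁ ≫ q).left ⟶ Over.mk q.left :=
  Over.homMk p₂.left (congr(($w).left)).symm

theorem isKernelOn_over_preimage_iff (w : p₁ ≫ q = p₂ ≫ q) (U : S.Opens) :
    IsKernelOn (fstOver p₁ q) (sndOver w) (Y.hom ⁻¹ᵁ U) ↔
      Function.Injective (pullbackSections q U) ∧
        ∀ a ∈ kernelSections p₁ p₂ U, ∃ y, pullbackSections q U y = a := by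
  -- both sides are instances of a condition on opens of `X` and `R` that are equal to the preimages
  have key (V : X.left.Opens) (W : R.left.Opens) (hV : V = q.left ⁻¹ᵁ Y.hom ⁻¹ᵁ U)
      (hW : W = (p₁ ≫ q).left ⁻¹ᵁ Y.hom ⁻¹ᵁ U) (h₁ : W ≤ p₁.left ⁻¹ᵁ V)
      (h₂ : W ≤ p₂.left ⁻¹ᵁ V) :
      IsKernelOn (fstOver p₁ q) (sndOver w) (Y.hom ⁻¹ᵁ U) ↔
        Function.Injective (q.left.appLE (Y.hom ⁻¹ᵁ U) V hV.le) ∧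
          ∀ a, p₁.left.appLE V W h₁ a = p₂.left.appLE V W h₂ a →
            ∃ y, q.left.appLE (Y.hom ⁻¹ᵁ U) V hV.le y = a := by
    subst hV hW
    rw [← Scheme.Hom.app_eq_appLE]
    exact ⟨fun h ↦ ⟨h.1, h.2⟩, fun h ↦ ⟨h.1, h.2⟩⟩
  refine key _ _ ?_ ?_ _ _
  · rw [← Scheme.Hom.comp_preimage, Over.w]
  · rw [← Scheme.Hom.comp_preimage, Over.w]

/-- The structure sheaf of the relative spectrum is the kernel on every open of the relative
spectrum, not only on preimages of opens of `S`. -/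
theorem isKernelOn_overToSpecKernel [IsAffineHom X.hom] [IsAffineHom R.hom]
    (V : (overSpecKernel p₁ p₂).left.Opens) :
    IsKernelOn (fstOver p₁ (overToSpecKernel p₁ p₂))
      (sndOver (condition_overToSpecKernel (p₁ := p₁) (p₂ := p₂))) V := by
  have : IsAffineHom (overSpecKernel p₁ p₂).hom :=
    inferInstanceAs (IsAffineHom (specKernelToBase p₁ p₂))
  have hq : IsAffineHom (overToSpecKernel p₁ p₂).left := by
    have : IsAffineHom ((overToSpecKernel p₁ p₂).left ≫ (overSpecKernel p₁ p₂).hom) := by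
      rw [Over.w]
      infer_instance
    exact .of_comp _ (overSpecKernel p₁ p₂).hom
  have hp : IsAffineHom (p₁ ≫ overToSpecKernel p₁ p₂).left := by
    have : IsAffineHom ((p₁ ≫ overToSpecKernel p₁ p₂).left ≫ (overSpecKernel p₁ p₂).hom) := by
      rw [Over.w]
      infer_instance
    exact .of_comp _ (overSpecKernel p₁ p₂).hom
  have : IsAffineHom (Over.mk (overToSpecKernel p₁ p₂).left).hom := hq
  have : IsAffineHom (Over.mk (p₁ ≫ overToSpecKernel p₁ p₂).left).hom := hp
  refine isKernelOn_of_basis (fun V y hy ↦ ?_) V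
  obtain ⟨U, hU⟩ := TopologicalSpace.Opens.mem_iSup.mp
    ((iSup_affineOpens_eq_top S).ge (Set.mem_univ ((overSpecKernel p₁ p₂).hom y)))
  have hW := U.2.preimage (overSpecKernel p₁ p₂).hom
  obtain ⟨r, hr, hyr⟩ := hW.exists_basicOpen_le ⟨y, hy⟩ hU
  refine ⟨_, hr, hyr, IsKernelOn.basicOpen hW ?_ r⟩
  refine (isKernelOn_over_preimage_iff _ _).mpr
    ⟨pullbackSections_overToSpecKernel_injective p₁ p₂ U.2, fun a ha ↦ ?_⟩
  rwa [← range_pullbackSections_overToSpecKernel p₁ p₂ U.2] at ha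

theorem isSpecKernel_overToSpecKernel [IsAffineHom X.hom] [IsAffineHom R.hom] :
    IsSpecKernel p₁ p₂ (overToSpecKernel p₁ p₂) where
  isAffineHom := inferInstanceAs (IsAffineHom (specKernelToBase p₁ p₂))
  injective U := ((isKernelOn_over_preimage_iff _ U).mp (isKernelOn_overToSpecKernel _)).1
  mem_range_iff U a := by
    rw [sub_eq_zero]
    refine ⟨?_, ((isKernelOn_over_preimage_iff _ U).mp (isKernelOn_overToSpecKernel _)).2 a⟩
    rintro ⟨y, rfl⟩
    rw [← RingHom.comp_apply, ← RingHom.comp_apply, ← pullbackSections_comp,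
      ← pullbackSections_comp, condition_overToSpecKernel]

end StructureSheaf

/-! ### Geometric points of the fibres -/

section GeometricPoints

variable {S : Scheme.{u}} {X R : Over S} {p₁ p₂ : R ⟶ X} {K : Type u} [Field K]

section AffinePoints

variable {W : S.Opens} (hW : IsAffineOpen W) (τ : Γ(S, W) →+* K)

/-- The `K`-point of `S` given by a `K`-point of the affine open `W ⊆ S`. -/
abbrev basePoint : Over S := Over.mk (Spec.map (CommRingCat.ofHom τ) ≫ hW.fromSpec)

variable {hW τ} in
/-- The `K`-point of an affine `S`-scheme `X` given by a ring homomorphism `Γ(X, W) → K` over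
`Γ(S, W) → K`. -/
def affinePoint [IsAffineHom X.hom] (ξ : sectionsOver X W →+* K)
    (h : ξ.comp (X.hom.app W).hom = τ) : basePoint hW τ ⟶ X :=
  Over.homMk (Spec.map (CommRingCat.ofHom ξ) ≫ (hW.preimage X.hom).fromSpec) <| by
    have := IsAffineOpen.SpecMap_appLE_fromSpec X.hom hW (hW.preimage X.hom) le_rfl
    rw [← Scheme.Hom.app_eq_appLE] at this
    change (_ ≫ _) ≫ _ = _ ≫ _
    rw [Category.assoc, ← this, ← Spec.map_comp_assoc, ← h]
    rfl

theorem affinePoint_injective [IsAffineHom X.hom] {ξ ξ' : sectionsOver X W →+* K}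
    {h : ξ.comp (X.hom.app W).hom = τ} {h' : ξ'.comp (X.hom.app W).hom = τ}
    (heq : affinePoint (hW := hW) ξ h = affinePoint ξ' h') : ξ = ξ' := by
  have := congr(($heq).left)
  change _ ≫ _ = _ ≫ _ at this
  rw [cancel_mono] at this
  exact congr(($(Spec.map_injective this)).hom)

/-- A `K`-point of `X` over a point of `W` lands in the affine preimage of `W`. -/
theorem exists_affinePoint_eq [IsAffineHom X.hom] (x : basePoint hW τ ⟶ X) :
    ∃ (ξ : sectionsOver X W →+* K) (h : ξ.comp (X.hom.app W).hom = τ), affinePoint ξ h = x := by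
  have hx : x.left ≫ X.hom = Spec.map (CommRingCat.ofHom τ) ≫ hW.fromSpec := Over.w x
  have hrange : Set.range x.left ⊆ Set.range (hW.preimage X.hom).fromSpec := by
    rw [IsAffineOpen.range_fromSpec]
    rintro _ ⟨z, rfl⟩
    change (X.hom (x.left z)) ∈ (W : Set S)
    rw [← Scheme.Hom.comp_apply, hx, ← hW.range_fromSpec, Scheme.Hom.comp_apply]
    exact ⟨_, rfl⟩
  let l : Spec (.of K) ⟶ Spec (sectionsOver X W) :=
    IsOpenImmersion.lift (hW.preimage X.hom).fromSpec x.left hrange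
  have hl : Spec.map (Spec.preimage l) ≫ (hW.preimage X.hom).fromSpec = x.left := by
    rw [Spec.map_preimage]
    exact IsOpenImmersion.lift_fac _ _ _
  have h : (Spec.preimage l).hom.comp (X.hom.app W).hom = τ := by
    have := IsAffineOpen.SpecMap_appLE_fromSpec X.hom hW (hW.preimage X.hom) le_rfl
    rw [← Scheme.Hom.app_eq_appLE] at this
    have h2 : Spec.map (X.hom.app W ≫ Spec.preimage l) = Spec.map (CommRingCat.ofHom τ) := by
      rw [← cancel_mono hW.fromSpec, Spec.map_comp, Category.assoc, this, reassoc_of% hl, hx]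
    exact congr(($(Spec.map_injective h2)).hom)
  exact ⟨_, h, Over.OverMorphism.ext hl⟩

theorem affinePoint_comp [IsAffineHom X.hom] [IsAffineHom R.hom] (p : R ⟶ X)
    (ρ : sectionsOver R W →+* K) (h : ρ.comp (R.hom.app W).hom = τ) :
    affinePoint (hW := hW) ρ h ≫ p = affinePoint (ρ.comp (pullbackSections p W)) (by
      rw [← h]
      ext a
      exact congrArg ρ (pullbackSections_app p W a)) := by
  ext1
  change (_ ≫ _) ≫ _ = Spec.map (CommRingCat.ofHom (pullbackSections p W) ≫ CommRingCat.ofHom ρ) ≫ _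
  have := IsAffineOpen.SpecMap_appLE_fromSpec p.left (hW.preimage X.hom) (hW.preimage R.hom)
    (preimage_le p W)
  rw [Category.assoc, ← this, Spec.map_comp, Category.assoc]
  rfl

end AffinePoints

/-- Every `K`-point of `S` factors through an affine open. -/
theorem exists_eq_specMap_comp_fromSpec (s : Spec (CommRingCat.of K) ⟶ S) :
    ∃ (W : S.Opens) (hW : IsAffineOpen W) (τ : Γ(S, W) →+* K),
      s = Spec.map (CommRingCat.ofHom τ) ≫ hW.fromSpec := by
  obtain ⟨⟨W, hW : IsAffineOpen W⟩, hs⟩ := TopologicalSpace.Opens.mem_iSup.mp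
    ((iSup_affineOpens_eq_top S).ge (Set.mem_univ (s default)))
  have hrange : Set.range s ⊆ Set.range hW.fromSpec := by
    rw [IsAffineOpen.range_fromSpec]
    rintro _ ⟨z, rfl⟩
    rwa [Subsingleton.elim z default]
  refine ⟨W, hW, (Spec.preimage (IsOpenImmersion.lift hW.fromSpec s hrange)).hom, ?_⟩
  rw [CommRingCat.ofHom_hom, Spec.map_preimage, IsOpenImmersion.lift_fac]

variable [IsAlgClosed K]

/-- Lying over: geometric points lift along an integral morphism that is injective on functions. -/
theorem nonempty_point_of_injective_app [IsIntegralHom X.hom]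
    (hinj : ∀ U, Function.Injective (X.hom.app U)) (s : Spec (CommRingCat.of K) ⟶ S) :
    Nonempty (Over.mk s ⟶ X) := by
  obtain ⟨W, hW, τ, rfl⟩ := exists_eq_specMap_comp_fromSpec s
  let : Algebra Γ(S, W) (sectionsOver X W) := (X.hom.app W).hom.toAlgebra
  let : Algebra Γ(S, W) K := τ.toAlgebra
  have : Algebra.IsIntegral Γ(S, W) (sectionsOver X W) := ⟨X.hom.isIntegral_app W hW⟩
  have : (RingHom.ker (algebraMap Γ(S, W) K)).IsPrime := RingHom.ker_isPrime _
  obtain ⟨Q, -, hQ, hQP⟩ := Ideal.exists_ideal_over_prime_of_isIntegral (S := sectionsOver X W)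
    (RingHom.ker (algebraMap Γ(S, W) K)) ⊥
    (((RingHom.injective_iff_ker_eq_bot (algebraMap Γ(S, W) (sectionsOver X W))).mp
      (hinj W)).trans_le bot_le)
  obtain ⟨ξ, -⟩ := exists_algHom_ker_eq Q hQP
  exact ⟨affinePoint (ξ : sectionsOver X W →+* K) ξ.comp_algebraMap⟩

/-- If the structure sheaf of `S` is the kernel, any two geometric points of `X` with the same image
in `S` are equivalent: the scheme version of `exists_algHom_comp_eq_of_equivalence`. -/
theorem pointRel_of_isKernelOn [IsFinite X.hom] [IsIntegralHom R.hom]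
    (h : ∀ U, IsKernelOn p₁ p₂ U) (s : Spec (CommRingCat.of K) ⟶ S)
    (heq : Equivalence (PointRel p₁ p₂ (Over.mk s))) (x x' : Over.mk s ⟶ X) :
    PointRel p₁ p₂ (Over.mk s) x x' := by
  obtain ⟨W, hW, τ, rfl⟩ := exists_eq_specMap_comp_fromSpec s
  let : Algebra Γ(S, W) (sectionsOver X W) := (X.hom.app W).hom.toAlgebra
  let : Algebra Γ(S, W) (sectionsOver R W) := (R.hom.app W).hom.toAlgebra
  let : Algebra Γ(S, W) K := τ.toAlgebra
  have : Module.Finite Γ(S, W) (sectionsOver X W) := X.hom.finite_app W hW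
  have : Algebra.IsIntegral Γ(S, W) (sectionsOver R W) := ⟨R.hom.isIntegral_app W hW⟩
  let π₁ : sectionsOver X W →ₐ[Γ(S, W)] sectionsOver R W :=
    { pullbackSections p₁ W with commutes' := pullbackSections_app p₁ W }
  let π₂ : sectionsOver X W →ₐ[Γ(S, W)] sectionsOver R W :=
    { pullbackSections p₂ W with commutes' := pullbackSections_app p₂ W }
  let Φ (ξ : sectionsOver X W →ₐ[Γ(S, W)] K) : basePoint hW τ ⟶ X :=
    affinePoint (ξ : sectionsOver X W →+* K) ξ.comp_algebraMap
  have hΦ (ξ ξ' : sectionsOver X W →ₐ[Γ(S, W)] K) :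
      (∃ r : sectionsOver R W →ₐ[Γ(S, W)] K, r.comp π₁ = ξ ∧ r.comp π₂ = ξ') ↔
        PointRel p₁ p₂ (basePoint hW τ) (Φ ξ) (Φ ξ') := by
    constructor
    · rintro ⟨r, rfl, rfl⟩
      exact ⟨affinePoint (r : sectionsOver R W →+* K) r.comp_algebraMap,
        affinePoint_comp .., affinePoint_comp ..⟩
    · rintro ⟨r, h₁, h₂⟩
      obtain ⟨ρ, hρ, rfl⟩ := exists_affinePoint_eq hW τ r
      rw [affinePoint_comp] at h₁ h₂
      refine ⟨{ ρ with commutes' := fun a ↦ congr($hρ a) }, ?_, ?_⟩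
      · ext a
        exact congr($(affinePoint_injective _ _ h₁) a)
      · ext a
        exact congr($(affinePoint_injective _ _ h₂) a)
  have hsurj (x : basePoint hW τ ⟶ X) : ∃ ξ, Φ ξ = x := by
    obtain ⟨ξ, hξ, rfl⟩ := exists_affinePoint_eq hW τ x
    exact ⟨{ ξ with commutes' := fun a ↦ congr($hξ a) }, rfl⟩
  obtain ⟨ξ, rfl⟩ := hsurj x
  obtain ⟨ξ', rfl⟩ := hsurj x'
  refine (hΦ ξ ξ').mp (exists_algHom_comp_eq_of_equivalence π₁ π₂ (fun b hb ↦ ?_) ?_ ξ ξ')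
  · exact (h W).exists_app_eq b hb
  · simp only [hΦ]
    exact heq.comap Φ

end GeometricPoints

/-! ### Coequalizers in the category of schemes -/

section Coequalizer

/-- A ring homomorphism whose values lie in the range of an injective one factors through it. -/
theorem exists_comp_eq_of_range_le {A B D : Type*} [CommRing A] [CommRing B] [CommRing D]
    {φ : A →+* B} (hφ : Function.Injective φ) (ψ : D →+* B) (h : ∀ d, ∃ a, φ a = ψ d) :
    ∃ χ : D →+* A, ∀ d, φ (χ d) = ψ d := by
  choose χ hχ using h
  exact ⟨{ toFun := χ
           map_one' := hφ (by simp [hχ])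
           map_mul' := fun x y ↦ hφ (by simp [hχ])
           map_zero' := hφ (by simp [hχ])
           map_add' := fun x y ↦ hφ (by simp [hχ]) }, hχ⟩

/-- A morphism `f : X ⟶ Z` descends along `q : X ⟶ Y` if `q` is a topological quotient map whose
fibres `f` contracts, and if the functions that `f` pulls back from `Z` come from functions on `Y`.
The morphism is constructed on spaces and on sheaves separately, with no reference to affine covers.
-/
theorem exists_hom_comp_eq_of_isQuotientMap {X Y Z : Scheme.{u}} {q : X ⟶ Y} {f : X ⟶ Z}
    (hq : Topology.IsQuotientMap q) (hfib : ∀ x x', q x = q x' → f x = f x')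
    (hinj : ∀ V, Function.Injective (q.app V))
    (hlift : ∀ (V : Y.Opens) (W : Z.Opens) (e : q ⁻¹ᵁ V ≤ f ⁻¹ᵁ W) (a : Γ(Z, W)),
      ∃ t, q.app V t = f.appLE W (q ⁻¹ᵁ V) e a) :
    ∃ u : Y ⟶ Z, q ≫ u = f := by
  let b : C(Y, Z) := hq.lift (f := ⟨q, q.continuous⟩) ⟨f, f.continuous⟩ hfib
  have hb (x : X) : b (q x) = f x :=
    congr($(hq.lift_comp (f := ⟨q, q.continuous⟩) ⟨f, f.continuous⟩ hfib) x)
  let B (W : Z.Opens) : Y.Opens := ⟨b ⁻¹' W, W.2.preimage b.continuous⟩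
  have hB (W : Z.Opens) : q ⁻¹ᵁ B W ≤ f ⁻¹ᵁ W := fun x hx ↦ by
    change b (q x) ∈ W at hx
    rwa [hb] at hx
  choose c hc using fun W : Z.Opens ↦ exists_comp_eq_of_range_le (hinj (B W))
    (f.appLE W (q ⁻¹ᵁ B W) (hB W)).hom (hlift (B W) W (hB W))
  have hnat {W W' : Z.Opens} (i : W' ≤ W) (i' : B W' ≤ B W) (a : Γ(Z, W)) :
      c W' (Z.presheaf.map (homOfLE i).op a) = Y.presheaf.map (homOfLE i').op (c W a) := by
    apply hinj
    have h1 : q.app (B W') (Y.presheaf.map (homOfLE i').op (c W a)) =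
        X.presheaf.map (homOfLE (q.preimage_mono i')).op (q.app (B W) (c W a)) :=
      congr($(q.naturality (homOfLE i').op) (c W a))
    rw [h1, hc, hc]
    change (f.appLE W' _ _) _ = _
    simp only [← CommRingCat.comp_apply, Scheme.Hom.map_appLE]
    change _ = X.presheaf.map _ (f.appLE W _ _ a)
    simp only [← CommRingCat.comp_apply, Scheme.Hom.appLE_map]
  let u₀ : Y.toPresheafedSpace ⟶ Z.toPresheafedSpace :=
    { base := TopCat.ofHom b
      c := { app := fun W ↦ CommRingCat.ofHom (c W.unop)
             naturality := fun W W' i ↦ by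
              ext a
              exact hnat i.unop.le (fun _ hy ↦ i.unop.le hy) a } }
  have hu₀ : q.toLRSHom.toHom ≫ u₀ = f.toLRSHom.toHom := by
    refine PresheafedSpace.ext _ _ (TopCat.hom_ext (ContinuousMap.ext hb)) ?_
    ext W a
    have key (e : Opposite.op (q ⁻¹ᵁ B W) ⟶ Opposite.op (f ⁻¹ᵁ W)) :
        X.presheaf.map e (f.appLE W (q ⁻¹ᵁ B W) (hB W) a) = f.app W a := by
      rw [← CommRingCat.comp_apply, Scheme.Hom.appLE_map, Scheme.Hom.app_eq_appLE]
    exact (congrArg (X.presheaf.map _) (hc W a)).trans (key _)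
  -- `q` is surjective, so locality on stalks follows from that of `f = q ≫ u`
  have hloc (y : Y) : IsLocalHom (u₀.stalkMap y).hom := by
    obtain ⟨x, rfl⟩ := hq.surjective y
    have hf : IsLocalHom (f.toLRSHom.toHom.stalkMap x).hom := f.toLRSHom.prop x
    have hcomp : IsLocalHom ((q.toLRSHom.toHom ≫ u₀).stalkMap x).hom := by
      rw [PresheafedSpace.stalkMap.congr_hom _ _ hu₀ x]
      have he {A B : CommRingCat.{u}} (e : A = B) : IsLocalHom (eqToHom e).hom := by
        subst e
        exact isLocalHom_of_isIso _
      exact @RingHom.isLocalHom_comp _ _ _ _ _ _ _ _ hf (he _)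
    rw [PresheafedSpace.stalkMap.comp] at hcomp
    exact @isLocalHom_of_comp _ _ _ _ _ _ (u₀.stalkMap (q x)).hom
      (q.toLRSHom.toHom.stalkMap x).hom hcomp
  refine ⟨⟨⟨u₀, hloc⟩⟩, ?_⟩
  exact Scheme.Hom.ext' (LocallyRingedSpace.Hom.ext' hu₀)

theorem hom_ext_of_surjective {X Y Z : Scheme.{u}} {q : X ⟶ Y} (hq : Function.Surjective q)
    (hinj : ∀ V, Function.Injective (q.app V)) {u v : Y ⟶ Z} (h : q ≫ u = q ≫ v) : u = v := by
  have hbase : u.base = v.base := by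
    ext y
    obtain ⟨x, rfl⟩ := hq y
    exact congr($h x)
  refine Scheme.Hom.ext hbase fun W ↦ ?_
  ext a
  apply hinj
  simp only [← CommRingCat.comp_apply, Scheme.Hom.app_eq_appLE, Scheme.Hom.appLE_map,
    Scheme.Hom.appLE_comp_appLE, h]

/-- The image is closed, and `1 = 0` on its complement. -/
theorem surjective_of_injective_app {X Y : Scheme.{u}} (q : X ⟶ Y) [IsIntegralHom q]
    (hinj : ∀ V, Function.Injective (q.app V)) : Function.Surjective q := by
  let V : Y.Opens := ⟨(Set.range q)ᶜ, q.isClosedMap.isClosed_range.isOpen_compl⟩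
  have hV : q ⁻¹ᵁ V = ⊥ := by
    ext x
    simp [V]
  have : Subsingleton Γ(X, q ⁻¹ᵁ V) := by
    rw [hV]
    infer_instance
  have h10 : (1 : Γ(Y, V)) = 0 := hinj V (Subsingleton.elim _ _)
  have hbot : V = ⊥ := by
    rw [← Y.basicOpen_of_isUnit (isUnit_one : IsUnit (1 : Γ(Y, V))), h10, Scheme.basicOpen_zero]
  have : (Set.range q)ᶜ = ∅ := congr(($hbot : Set Y))
  exact Set.range_eq_univ.mp (Set.compl_empty_iff.mp this)

theorem exists_geometricPoint {P : Scheme.{u}} (z : P) :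
    ∃ (K : Type u) (_ : Field K) (_ : IsAlgClosed K) (k : Spec (CommRingCat.of K) ⟶ P)
      (o : Spec (CommRingCat.of K)), k o = z := by
  refine ⟨AlgebraicClosure (P.residueField z), inferInstance, inferInstance,
    Spec.map (CommRingCat.ofHom (algebraMap (P.residueField z) _)) ≫
      P.fromSpecResidueField z, default, ?_⟩
  rw [Scheme.Hom.comp_apply, Scheme.fromSpecResidueField_apply]

variable {S : Scheme.{u}} {X R : Over S} {p₁ p₂ : R ⟶ X}

/-- If the structure sheaf of `S` is the kernel of `p₁^* - p₂^*`, then `X ⟶ S` is the coequalizer of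
`p₁` and `p₂` in the category of schemes. -/
theorem isColimit_of_isKernelOn [IsFinite X.hom] [IsIntegralHom R.hom]
    (h : ∀ U, IsKernelOn p₁ p₂ U)
    (heq : ∀ (K : Type u) [Field K] [IsAlgClosed K] (s : Spec (CommRingCat.of K) ⟶ S),
      Equivalence (PointRel p₁ p₂ (Over.mk s))) :
    ∃ w : p₁.left ≫ X.hom = p₂.left ≫ X.hom, Nonempty (IsColimit (Cofork.ofπ X.hom w)) := by
  have hinj (U) := (h U).injective
  have hsurj := surjective_of_injective_app X.hom hinj
  -- points with the same image in `S` come from a geometric point of the fibre product, whose two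
  -- projections are equivalent
  have hpt (x x' : X.left) (hx : X.hom x = X.hom x') : ∃ r, p₁.left r = x ∧ p₂.left r = x' := by
    obtain ⟨z, rfl, rfl⟩ := Scheme.Pullback.exists_preimage_pullback x x' hx
    obtain ⟨K, _, _, k, o, rfl⟩ := exists_geometricPoint z
    let x : Over.mk (k ≫ pullback.fst _ _ ≫ X.hom) ⟶ X := Over.homMk (k ≫ pullback.fst _ _)
    let x' : Over.mk (k ≫ pullback.fst _ _ ≫ X.hom) ⟶ X :=
      Over.homMk (k ≫ pullback.snd _ _) (by simp [pullback.condition])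
    obtain ⟨r, h₁, h₂⟩ := pointRel_of_isKernelOn h _ (heq K _) x x'
    refine ⟨r.left o, ?_, ?_⟩
    · rw [← Scheme.Hom.comp_apply, ← Over.comp_left, h₁, ← Scheme.Hom.comp_apply]
      rfl
    · rw [← Scheme.Hom.comp_apply, ← Over.comp_left, h₂, ← Scheme.Hom.comp_apply]
      rfl
  have hquot : Topology.IsQuotientMap X.hom :=
    (X.hom.isClosedMap).isQuotientMap X.hom.continuous hsurj
  have w : p₁.left ≫ X.hom = p₂.left ≫ X.hom := by rw [Over.w, Over.w]
  have hdesc {Z : Scheme.{u}} (f : X.left ⟶ Z) (hf : p₁.left ≫ f = p₂.left ≫ f) :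
      ∃ u : S ⟶ Z, X.hom ≫ u = f := by
    refine exists_hom_comp_eq_of_isQuotientMap hquot (fun x x' hx ↦ ?_) hinj fun V W e a ↦ ?_
    · obtain ⟨r, rfl, rfl⟩ := hpt x x' hx
      rw [← Scheme.Hom.comp_apply, hf, Scheme.Hom.comp_apply]
    · refine (h V).exists_app_eq _ ?_
      change p₁.left.appLE _ _ _ (f.appLE _ _ _ a) = p₂.left.appLE _ _ _ (f.appLE _ _ _ a)
      simp only [← CommRingCat.comp_apply, Scheme.Hom.appLE_comp_appLE, hf]
  exact ⟨w, ⟨Cofork.IsColimit.mk' _ fun s ↦ ⟨(hdesc s.π s.condition).choose,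
    (hdesc s.π s.condition).choose_spec, fun hm ↦ hom_ext_of_surjective hsurj hinj
      (hm.trans (hdesc s.π s.condition).choose_spec.symm)⟩⟩⟩

end Coequalizer

/-! ### Geometric quotients -/

section GeometricQuotient

variable {S : Scheme.{u}} {X R Y : Over S} {p₁ p₂ : R ⟶ X} {q : X ⟶ Y}

/-- For points with the same image in `Y`, being equivalent over `Y` and over `S` are the same. -/
theorem pointRel_over_iff (w : p₁ ≫ q = p₂ ≫ q) {T : Scheme.{u}} (t : T ⟶ Y.left)
    {x x' : Over.mk (t ≫ Y.hom) ⟶ X} (hx : x.left ≫ q.left = t) (hx' : x'.left ≫ q.left = t) :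
    PointRel (fstOver p₁ q) (sndOver w) (Over.mk t) (Over.homMk x.left hx)
        (Over.homMk x'.left hx') ↔
      PointRel p₁ p₂ (Over.mk (t ≫ Y.hom)) x x' := by
  constructor
  · rintro ⟨r, h₁, h₂⟩
    have hr : r.left ≫ (p₁ ≫ q).left = t := Over.w r
    refine ⟨Over.homMk r.left ?_, Over.OverMorphism.ext congr(($h₁).left),
      Over.OverMorphism.ext congr(($h₂).left)⟩
    change r.left ≫ R.hom = t ≫ Y.hom
    rw [← Over.w (p₁ ≫ q), reassoc_of% hr]
  · rintro ⟨r, h₁, h₂⟩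
    refine ⟨Over.homMk r.left ?_, Over.OverMorphism.ext congr(($h₁).left),
      Over.OverMorphism.ext congr(($h₂).left)⟩
    change r.left ≫ p₁.left ≫ q.left = t
    exact (Category.assoc ..).symm.trans (congr(($h₁).left ≫ q.left).trans hx)

theorem equivalence_pointRel_over (w : p₁ ≫ q = p₂ ≫ q) {T : Scheme.{u}} (t : T ⟶ Y.left)
    (h : Equivalence (PointRel p₁ p₂ (Over.mk (t ≫ Y.hom)))) :
    Equivalence (PointRel (fstOver p₁ q) (sndOver w) (Over.mk t)) := by
  let Φ (x : Over.mk t ⟶ Over.mk q.left) : Over.mk (t ≫ Y.hom) ⟶ X :=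
    Over.homMk x.left (by
      have : x.left ≫ q.left = t := Over.w x
      change x.left ≫ X.hom = t ≫ Y.hom
      rw [← Over.w q, reassoc_of% this])
  have hΦ (x x') : PointRel (fstOver p₁ q) (sndOver w) (Over.mk t) x x' ↔
      PointRel p₁ p₂ (Over.mk (t ≫ Y.hom)) (Φ x) (Φ x') :=
    pointRel_over_iff w t (x := Φ x) (x' := Φ x') (Over.w x) (Over.w x')
  have heq : PointRel (fstOver p₁ q) (sndOver w) (Over.mk t) = fun x x' ↦
      PointRel p₁ p₂ (Over.mk (t ≫ Y.hom)) (Φ x) (Φ x') := by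
    ext x x'
    exact hΦ x x'
  rw [heq]
  exact h.comap Φ

/-- A finite morphism `q : X ⟶ Y` through which the two composites `R ⇉ X ⟶ Y` agree is the
geometric quotient as soon as the structure sheaf of `Y` is the kernel. -/
theorem isGeometricQuotient_of_isKernelOn (w : p₁ ≫ q = p₂ ≫ q) [IsFinite q.left]
    [IsIntegralHom p₁.left] (hker : ∀ V, IsKernelOn (fstOver p₁ q) (sndOver w) V)
    (heq : ∀ (K : Type u) [Field K] [IsAlgClosed K] (s : Spec (CommRingCat.of K) ⟶ S),
      Equivalence (PointRel p₁ p₂ (Over.mk s))) :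
    IsGeometricQuotient p₁ p₂ q := by
  have : IsFinite (Over.mk q.left).hom := ‹IsFinite q.left›
  have : IsIntegralHom (Over.mk (p₁ ≫ q).left).hom :=
    inferInstanceAs (IsIntegralHom (p₁.left ≫ q.left))
  have heq' (K : Type u) [Field K] [IsAlgClosed K] (t : Spec (CommRingCat.of K) ⟶ Y.left) :
      Equivalence (PointRel (fstOver p₁ q) (sndOver w) (Over.mk t)) :=
    equivalence_pointRel_over w t (heq K _)
  refine ⟨isColimit_of_isKernelOn hker heq', ‹_›, fun K _ _ s ↦ ?_⟩
  have hrel (x x' : Over.mk s ⟶ X) :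
      PointRel p₁ p₂ (Over.mk s) x x' ↔ x' ≫ q = x ≫ q := by
    constructor
    · rintro ⟨r, rfl, rfl⟩
      rw [Category.assoc, Category.assoc, w]
    · intro h
      obtain ⟨t, ht⟩ : ∃ t : Spec (CommRingCat.of K) ⟶ Y.left, x.left ≫ q.left = t := ⟨_, rfl⟩
      have ht' : x'.left ≫ q.left = t := by rw [← ht]; exact congr(($h).left)
      have hs : s = t ≫ Y.hom := by
        rw [← ht, Category.assoc, Over.w]
        exact (Over.w x).symm
      subst hs
      exact (pointRel_over_iff w t ht ht').mp (pointRel_of_isKernelOn hker t (heq' K t) _ _)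
  ext O
  constructor
  · rintro ⟨y, rfl⟩
    obtain ⟨x₀⟩ := nonempty_point_of_injective_app (X := Over.mk q.left)
      (fun V ↦ (hker V).injective) y.left
    have hx₀ : x₀.left ≫ q.left = y.left := Over.w x₀
    let x : Over.mk s ⟶ X := Over.homMk x₀.left (by
      rw [← Over.w q, reassoc_of% hx₀, Over.w])
    have hx : x ≫ q = y := Over.OverMorphism.ext hx₀
    refine ⟨x, ?_⟩
    ext x'
    exact (hrel x x').trans (by rw [hx]; rfl)
  · rintro ⟨x, rfl⟩
    refine ⟨x ≫ q, ?_⟩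
    ext x'
    exact (hrel x x').symm

end GeometricQuotient

end SchemeQuotient

end

/-- A finite set theoretic equivalence relation on a scheme that is finite over a Noetherian
scheme `S` has a geometric quotient, namely the relative spectrum over `S` of
`ker [p₁^* - p₂^* : 𝒪_X ⟶ 𝒪_R]`. -/
theorem mainTheorem6 (S : Scheme.{u}) [AlgebraicGeometry.IsNoetherian S] (X R : Over S)
    (hX : IsFinite X.hom) (p₁ p₂ : R ⟶ X)
    (hR : SchemeQuotient.IsFiniteSetTheoreticEquivRel p₁ p₂) :
    ∃ (Y : Over S) (q : X ⟶ Y), SchemeQuotient.IsGeometricQuotient p₁ p₂ q ∧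
      SchemeQuotient.IsSpecKernel p₁ p₂ q := by
  have := hR.isFinite_fst
  have : IsFinite R.hom := by
    rw [← Over.w p₁]
    infer_instance
  have hspec := SchemeQuotient.isSpecKernel_overToSpecKernel (p₁ := p₁) (p₂ := p₂)
  have := hspec.isAffineHom
  have : IsFinite ((SchemeQuotient.overToSpecKernel p₁ p₂).left ≫
      (SchemeQuotient.overSpecKernel p₁ p₂).hom) := by
    rwa [Over.w]
  have : IsFinite (SchemeQuotient.overToSpecKernel p₁ p₂).left :=
    .of_comp _ (SchemeQuotient.overSpecKernel p₁ p₂).hom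
  exact ⟨_, SchemeQuotient.overToSpecKernel p₁ p₂,
    SchemeQuotient.isGeometricQuotient_of_isKernelOn SchemeQuotient.condition_overToSpecKernel
      SchemeQuotient.isKernelOn_overToSpecKernel hR.equivalence, hspec⟩
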